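/- Let $n\ge 1$ be an integer. For $f:\{0,1\}^n\to\mathbb{R}$ let $\widehat f(S)=2^{-n}\sum_{x\in\{0,1\}^n} f(x)(-1)^{\sum_{j\in S}x_j}$ for $S\subseteq\{1,\dots,n\}$, and let $\deg(f)$ be the least integer $m\ge 0$ such that $\widehat f(S)=0$ for all $|S|>m$. Put $\|f\|_\infty=\max_{x\in\{0,1\}^n}|f(x)|$. For real $d\ge 0$ let $$E_d^n(f)=\inf_{g:\{0,1\}^n\to\mathbb{R},\ \deg(g)\le d}\|f-g\|_\infty ,$$ and let $$s(f)=\max_{x\in\{0,1\}^n}\sum_{j=1}^n|f(x)-f(x^{j})|$$ be the sensitivity of $f$, where $x^{j}$ is $x$ with its $j$-th coordinate flipped. Call $f$ symmetric if $f(x_{\sigma(1)},\dots,x_{\sigma(n)})=f(x_1,\dots,x_n)$ for every permutation $\sigma$ of $\{1,\dots,n\}$ and every $x\in\{0,1\}^n$. There exists a universal constant $C>0$ such that for every $n\ge 1$, every symmetric $f:\{0,1\}^n\to\mathbb{R}$ and every real $d\in(0,n]$, $$E_d^n(f)\le \frac{C}{d}\,s(f).$$ Moreover, this bound is optimal: for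 every $n\ge 1$ and every real $d$ with $1\le d<n$ there exists a symmetric function $f:\{0,1\}^n\to\mathbb{R}$ with $s(f)>0$ such that $$E_d^n(f)\ge \frac{1}{8d}\,s(f).$$ -/

import Mathlib

noncomputable section

namespace Hypercube

/-- The discrete cube `{0,1}^n`; the bit `1` is `true`. -/
abbrev Cube (n : ℕ) : Type := Fin n → Bool

/-- The point `x^j`, obtained from `x` by flipping its `j`-th coordinate. -/
def flip {n : ℕ} (x : Cube n) (j : Fin n) : Cube n :=
  Function.update x j (!(x j))

/-- The Walsh function `W_S(x) = (-1)^(∑_{j ∈ S} x_j)`. -/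
def walsh {n : ℕ} (S : Finset (Fin n)) (x : Cube n) : ℝ :=
  (-1 : ℝ) ^ (∑ j ∈ S, (x j).toNat)

/-- The Fourier-Walsh coefficient `𝔼 f(X) W_S(X)`, with `X` uniform on the cube. -/
def walshCoeff {n : ℕ} (f : Cube n → ℝ) (S : Finset (Fin n)) : ℝ :=
  (∑ x : Cube n, f x * walsh S x) / (2 : ℝ) ^ n

/-- The degree of `f`: the least `m` such that the coefficients of `f` at all sets of more than
`m` elements vanish. (The set below always contains `n`.) -/
def degree {n : ℕ} (f : Cube n → ℝ) : ℕ :=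
  sInf {m : ℕ | ∀ S : Finset (Fin n), m < S.card → walshCoeff f S = 0}

/-- The error `E_d^n(f)` of best uniform approximation of `f` by functions of degree at most `d`.
The norm on `Cube n → ℝ` is the maximum norm. For `d ≥ 0` the infimum runs over a nonempty
family of nonnegative numbers. -/
def approxError {n : ℕ} (d : ℝ) (f : Cube n → ℝ) : ℝ :=
  ⨅ g : {g : Cube n → ℝ // (degree g : ℝ) ≤ d}, ‖f - g.1‖

/-- The sensitivity `s(f) = max_x ∑_j |f(x) - f(x^j)|`. -/
def sensitivity {n : ℕ} (f : Cube n → ℝ) : ℝ :=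
  Finset.univ.sup' Finset.univ_nonempty fun x : Cube n => ∑ j : Fin n, |f x - f (flip x j)|

/-- `f` is symmetric: its value does not change when the variables are permuted. -/
def IsSymmetric {n : ℕ} (f : Cube n → ℝ) : Prop :=
  ∀ (σ : Equiv.Perm (Fin n)) (x : Cube n), f (fun i => x (σ i)) = f x

end Hypercube

end

/-!
A symmetric function on the cube is a function `φ` of the Hamming weight `|x|`. A point of weight
`k` has `n - k` upper neighbours, and a point of weight `k + 1` has `k + 1` lower ones, so
`n * |φ k - φ (k + 1)|` is at most twice the sensitivity `s`
(`Hypercube.mul_abs_step_le_sensitivity`). Extended to the line and rescaled to `[-1, 1]`, `φ`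
becomes `s`-Lipschitz. Since a polynomial of degree `m` in `|x|` has degree at most `m` on the cube
(`Hypercube.degree_eval_hammingWeight_le`), the upper bound reduces to Jackson's inequality for
Lipschitz functions, and the constant obtained is `π`.

Jackson's inequality (`Korovkin.exists_polynomial_near_of_lipschitz`) is proved by averaging
`F ∘ cos` against a nonnegative trigonometric kernel of degree `m`. By positivity the error only
depends on the first Fourier coefficient of the normalized kernel, and the squared modulus of
`∑ sin ((k + 1) ε) e ^ (i k v)` with `ε = π / (m + 2)` has first coefficient `cos ε`, which is
within `ε ^ 2 / 2` of `1`. The average is taken over `m + 2` equispaced nodes, which is exact for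
the trigonometric polynomials involved and makes integrals unnecessary.

For the lower bound put `m = ⌊d⌋`, `δ = ⌊n / (m + 1)⌋` and let `φ` be the triangle wave of period
`2δ` and slope `±1`, whose sensitivity is at most `n`. On points that are constant on `m + 1`
blocks of length `δ`, it is `δ / 2` plus `δ / 2` times the parity of the blocks. A function of
degree at most `m` on the cube becomes a function of degree at most `m` of the `m + 1` blocks, hence
is orthogonal to that parity; so the error of approximation is at least `δ / 2 ≥ n / (8 m)`
(`Hypercube.half_le_norm_triangleWave_sub`).
-/

/-! ### Uniform approximation of Lipschitz functions by polynomials -/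

open Finset Real in
theorem sum_cos_equispaced_eq_zero {N : ℕ} (hN : N ≠ 0) {q : ℤ} (hq : ¬ (N : ℤ) ∣ q) (θ : ℝ) :
    ∑ j ∈ range N, cos (q * (θ + 2 * π * j / N)) = 0 := by
  have hζ := Complex.isPrimitiveRoot_exp N hN
  set ζ : ℂ := Complex.exp (2 * π * Complex.I / N) with hζdef
  have h1 : ζ ^ q ≠ 1 := fun h => hq ((hζ.zpow_eq_one_iff_dvd q).1 h)
  have hgeom : ∑ j ∈ range N, (ζ ^ q) ^ j = 0 := by
    rw [geom_sum_eq h1, ← zpow_natCast, ← zpow_mul, mul_comm, zpow_mul, zpow_natCast, hζ.pow_eq_one]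
    simp
  have hterm : ∀ j : ℕ, Complex.exp ((q * (θ + 2 * π * j / N) : ℝ) * Complex.I)
      = Complex.exp (q * θ * Complex.I) * (ζ ^ q) ^ j := by
    intro j
    rw [hζdef, ← Complex.exp_int_mul, ← Complex.exp_nat_mul, ← Complex.exp_add]
    congr 1
    push_cast
    ring
  have hsum : ∑ j ∈ range N, Complex.exp ((q * (θ + 2 * π * j / N) : ℝ) * Complex.I) = 0 := by
    simp_rw [hterm, ← mul_sum, hgeom, mul_zero]
  have := congrArg Complex.re hsum
  simpa only [Complex.re_sum, Complex.exp_ofReal_mul_I_re, Complex.zero_re] using this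

namespace Korovkin
open Finset Real

/-- The coefficients of the trigonometric polynomial whose squared modulus is the kernel. Indices
are shifted by one, so that the sine vanishes just outside the range `0 ≤ k ≤ m`. -/
noncomputable def sineCoeff (m k : ℕ) : ℝ := sin ((k + 1) * (π / (m + 2)))

/-- Korovkin's kernel `|∑ k ≤ m, sineCoeff m k * e ^ (i k v)| ^ 2`, a nonnegative cosine polynomial
of degree `m`, left unnormalized and with the square expanded. -/
noncomputable def kernel (m : ℕ) (v : ℝ) : ℝ :=
  ∑ k ∈ range (m + 1), ∑ l ∈ range (m + 1), sineCoeff m k * sineCoeff m l * cos (((k : ℤ) - l : ℤ) * v)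

/-- The mean value of `kernel m` over a period. -/
noncomputable def mass (m : ℕ) : ℝ := ∑ k ∈ range (m + 1), sineCoeff m k ^ 2

theorem kernel_nonneg (m : ℕ) (v : ℝ) : 0 ≤ kernel m v := by
  have : kernel m v = (∑ k ∈ range (m + 1), sineCoeff m k * cos (k * v)) ^ 2
      + (∑ k ∈ range (m + 1), sineCoeff m k * sin (k * v)) ^ 2 := by
    rw [sq, sq, sum_mul_sum, sum_mul_sum, ← sum_add_distrib]
    refine sum_congr rfl fun k _ => ?_
    rw [← sum_add_distrib]
    refine sum_congr rfl fun l _ => ?_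
    push_cast
    rw [sub_mul, cos_sub]
    ring
  rw [this]
  positivity

theorem mass_pos (m : ℕ) : 0 < mass m := by
  have h0 : 0 < sineCoeff m 0 := by
    have h2 : (1 : ℝ) < m + 2 := by linarith [(Nat.cast_nonneg m : (0 : ℝ) ≤ m)]
    apply sin_pos_of_pos_of_lt_pi
    · positivity
    · simpa using div_lt_self pi_pos h2
  exact (pow_pos h0 2).trans_le
    (single_le_sum (f := fun k => sineCoeff m k ^ 2) (fun _ _ => sq_nonneg _) (mem_range.2 m.succ_pos))

theorem sineCoeff_succ_self (m : ℕ) : sineCoeff m (m + 1) = 0 := by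
  have : ((m + 1 : ℕ) + 1 : ℝ) * (π / (m + 2)) = π := by
    have : (m + 2 : ℝ) ≠ 0 := by positivity
    push_cast
    field_simp
    ring
  rw [sineCoeff, this, sin_pi]

/-- The recurrence `sin ((k + 2) ε) + sin (k ε) = 2 cos ε sin ((k + 1) ε)`, summed against the
sequence itself; this makes the first Fourier coefficient of the normalized kernel `cos ε`. -/
theorem sum_sineCoeff_mul_succ (m : ℕ) :
    ∑ k ∈ range (m + 1), sineCoeff m k * sineCoeff m (k + 1) = cos (π / (m + 2)) * mass m := by
  set ε := π / (m + 2 : ℝ) with hε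
  let c : ℕ → ℝ := fun k => sin (k * ε) * sineCoeff m k
  have hc : ∀ k, c (k + 1) = sineCoeff m k * sineCoeff m (k + 1) := fun k => by
    simp [c, sineCoeff, hε]
  have hshift : ∑ k ∈ range (m + 1), c (k + 1) = ∑ k ∈ range (m + 1), c k := by
    have h := (sum_range_succ c (m + 1)).symm.trans (sum_range_succ' c (m + 1))
    have h0 : c 0 = 0 := by simp [c]
    have h1 : c (m + 1) = 0 := by simp [c, sineCoeff_succ_self]
    linarith
  have hrec : ∀ k, c (k + 1) + c k = 2 * (cos ε * sineCoeff m k ^ 2) := fun k => by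
    have e1 : sineCoeff m (k + 1) = sin ((k + 1) * ε + ε) := by
      simp only [sineCoeff, hε]; push_cast; ring_nf
    have e2 : (k : ℝ) * ε = (k + 1) * ε - ε := by ring
    have e3 : sineCoeff m k = sin ((k + 1) * ε) := rfl
    rw [hc, e1]
    simp only [c]
    rw [e2, e3, sin_add, sin_sub]
    ring
  have h2 : ∑ k ∈ range (m + 1), c (k + 1) + ∑ k ∈ range (m + 1), c k
      = 2 * (cos ε * mass m) := by
    rw [← sum_add_distrib, mass, mul_sum, mul_sum]
    exact sum_congr rfl fun k _ => hrec k
  simp_rw [← hc]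
  linarith

/-- Summation over `m + 2` equispaced nodes integrates cosines of frequency less than `m + 2`
exactly. This covers the kernel, and also its product with a cosine. -/
theorem sum_cos_node (m : ℕ) {q : ℤ} (hq : q.natAbs < m + 2) (θ : ℝ) :
    ∑ j ∈ range (m + 2), cos (q * (θ + 2 * π * j / (m + 2))) = if q = 0 then (m + 2 : ℝ) else 0 := by
  split_ifs with h
  · simp [h]
  · have hd : ¬ ((m + 2 : ℕ) : ℤ) ∣ q := fun hd => by
      have := Nat.le_of_dvd (Int.natAbs_pos.2 h) (Int.natCast_dvd.1 hd)
      omega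
    simpa using sum_cos_equispaced_eq_zero (N := m + 2) (by omega) hd θ

theorem sum_kernel_node (m : ℕ) (θ : ℝ) :
    ∑ j ∈ range (m + 2), kernel m (θ + 2 * π * j / (m + 2)) = (m + 2) * mass m := by
  simp only [kernel]
  rw [sum_comm, mass, mul_sum]
  refine sum_congr rfl fun k hk => ?_
  rw [mem_range] at hk
  rw [sum_comm]
  have : ∀ l ∈ range (m + 1), ∑ j ∈ range (m + 2), sineCoeff m k * sineCoeff m l *
      cos (((k : ℤ) - l : ℤ) * (θ + 2 * π * j / (m + 2)))
      = if k = l then (m + 2 : ℝ) * sineCoeff m k ^ 2 else 0 := by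
    intro l hl
    rw [mem_range] at hl
    rw [← mul_sum, sum_cos_node m (by omega)]
    by_cases h : k = l
    · subst h; simp; ring
    · rw [if_neg (by omega), if_neg h, mul_zero]
  rw [sum_congr rfl this, sum_ite_eq, if_pos (mem_range.2 hk)]

theorem sum_kernel_mul_cos_node (m : ℕ) (θ : ℝ) :
    ∑ j ∈ range (m + 2), kernel m (θ + 2 * π * j / (m + 2)) * cos (θ + 2 * π * j / (m + 2))
      = (m + 2) * (cos (π / (m + 2)) * mass m) := by
  have hprod : ∀ (q : ℤ) (v : ℝ), cos (q * v) * cos v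
      = (cos ((q + 1 : ℤ) * v) + cos ((q - 1 : ℤ) * v)) / 2 := fun q v => by
    push_cast
    rw [add_mul, sub_mul, one_mul, cos_add, cos_sub]
    ring
  have hterm : ∀ k ∈ range (m + 1), ∀ l ∈ range (m + 1), ∑ j ∈ range (m + 2),
      sineCoeff m k * sineCoeff m l * cos (((k : ℤ) - l : ℤ) * (θ + 2 * π * j / (m + 2)))
        * cos (θ + 2 * π * j / (m + 2))
      = (m + 2) / 2 * ((if l = k + 1 then sineCoeff m k * sineCoeff m l else 0)
          + (if k = l + 1 then sineCoeff m k * sineCoeff m l else 0)) := by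
    intro k hk l hl
    rw [mem_range] at hk hl
    simp_rw [mul_assoc _ (cos _) (cos _), hprod, ← mul_sum, ← sum_div, sum_add_distrib]
    rw [sum_cos_node m (by omega), sum_cos_node m (by omega)]
    have e1 : ((k : ℤ) - l + 1 = 0) ↔ l = k + 1 := by omega
    have e2 : ((k : ℤ) - l - 1 = 0) ↔ k = l + 1 := by omega
    simp only [e1, e2]
    split_ifs <;> ring
  have hrow : ∀ k ∈ range (m + 1), (∑ l ∈ range (m + 1),
      if l = k + 1 then sineCoeff m k * sineCoeff m l else 0) = sineCoeff m k * sineCoeff m (k + 1) := by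
    intro k hk
    rw [sum_ite_eq']
    split_ifs with h
    · rfl
    · have : k = m := by simp only [mem_range] at h hk; omega
      rw [this, sineCoeff_succ_self, mul_zero]
  have hcol : (∑ k ∈ range (m + 1), ∑ l ∈ range (m + 1),
      if k = l + 1 then sineCoeff m k * sineCoeff m l else 0)
        = ∑ k ∈ range (m + 1), sineCoeff m k * sineCoeff m (k + 1) := by
    rw [sum_comm]
    refine sum_congr rfl fun k hk => (hrow k hk ▸ sum_congr rfl fun l _ => ?_)
    rw [mul_comm]
  simp only [kernel, sum_mul]
  rw [sum_comm]
  calc _ = ∑ k ∈ range (m + 1), ∑ l ∈ range (m + 1), (m + 2 : ℝ) / 2 *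
        ((if l = k + 1 then sineCoeff m k * sineCoeff m l else 0)
          + (if k = l + 1 then sineCoeff m k * sineCoeff m l else 0)) := by
        refine sum_congr rfl fun k hk => ?_
        rw [sum_comm]
        exact sum_congr rfl fun l hl => hterm k hk l hl
    _ = _ := by
        simp_rw [← mul_sum, sum_add_distrib]
        rw [sum_congr rfl hrow, hcol, sum_sineCoeff_mul_succ]
        ring

/-- The inequality `2 t ≤ ε + t ^ 2 / ε`, used in place of Cauchy-Schwarz; the quadratic term is
bounded by `2 * (1 - cos (a - b))`, which kernel averages compute exactly. -/
theorem abs_cos_sub_cos_le {ε : ℝ} (hε : 0 < ε) (a b : ℝ) :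
    |cos a - cos b| ≤ ε / 2 + (1 - cos (a - b)) / ε := by
  have hsq : (cos a - cos b) ^ 2 ≤ 2 * (1 - cos (a - b)) := by
    rw [cos_sub]
    nlinarith [sq_nonneg (sin a - sin b), sin_sq_add_cos_sq a, sin_sq_add_cos_sq b]
  have h1 : |cos a - cos b| * ε ≤ (ε / 2 + (1 - cos (a - b)) / ε) * ε := by
    have : (ε / 2 + (1 - cos (a - b)) / ε) * ε = ε ^ 2 / 2 + (1 - cos (a - b)) := by
      field_simp
    rw [this]
    nlinarith [sq_nonneg (|cos a - cos b| - ε), sq_abs (cos a - cos b)]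
  exact le_of_mul_le_mul_right h1 hε

/-- The kernel concentrates at distance `π / (m + 2)`. -/
theorem sum_kernel_mul_dist_le (m : ℕ) (θ : ℝ) :
    ∑ j ∈ range (m + 2), kernel m (θ + 2 * π * j / (m + 2)) *
      |cos θ - cos (2 * π * j / (m + 2))| ≤ π / (m + 2) * ((m + 2) * mass m) := by
  set ε := π / (m + 2 : ℝ) with hε
  have hεpos : 0 < ε := by positivity
  have hM := mass_pos m
  calc _ ≤ ∑ j ∈ range (m + 2), ((ε / 2 + 1 / ε) * kernel m (θ + 2 * π * j / (m + 2))
        - 1 / ε * (kernel m (θ + 2 * π * j / (m + 2)) * cos (θ + 2 * π * j / (m + 2)))) := by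
        refine sum_le_sum fun j _ => ?_
        have h := mul_le_mul_of_nonneg_left
          (abs_cos_sub_cos_le hεpos θ (-(2 * π * j / (m + 2))))
          (kernel_nonneg m (θ + 2 * π * j / (m + 2)))
        rw [cos_neg, sub_neg_eq_add] at h
        refine h.trans (le_of_eq ?_)
        ring
    _ = (m + 2) * mass m * (ε / 2 + (1 - cos ε) / ε) := by
        rw [sum_sub_distrib, ← mul_sum, ← mul_sum, sum_kernel_node, sum_kernel_mul_cos_node]
        ring
    _ ≤ (m + 2) * mass m * ε := by
        gcongr
        have : (1 - cos ε) / ε ≤ ε / 2 := by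
          rw [div_le_iff₀ hεpos]
          nlinarith [one_sub_sq_div_two_le_cos (x := ε)]
        linarith
    _ = _ := by ring

open Polynomial in
/-- Jackson's inequality on `[-1, 1]` for Lipschitz functions, with an explicit constant. -/
theorem exists_polynomial_near_of_lipschitz (F : ℝ → ℝ) (L : ℝ)
    (hF : ∀ x y, |F x - F y| ≤ L * |x - y|) (m : ℕ) :
    ∃ p : ℝ[X], p.natDegree ≤ m ∧ ∀ x ∈ Set.Icc (-1 : ℝ) 1, |F x - p.eval x| ≤ π * L / (m + 2) := by
  have hM : 0 < (m + 2) * mass m := mul_pos (by positivity) (mass_pos m)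
  have hL : 0 ≤ L := by simpa using (abs_nonneg _).trans (hF 1 0)
  let u : ℕ → ℝ := fun j => 2 * π * j / (m + 2)
  -- Symmetrizing the kernel in `θ` cancels the sine terms, so that averaging against it gives a
  -- polynomial in `cos θ`.
  let H : ℝ → ℕ → ℝ := fun θ j => (kernel m (θ + u j) + kernel m (-θ + u j)) / 2
  have hH0 : ∀ θ j, 0 ≤ H θ j := fun θ j => by
    have := kernel_nonneg m (θ + u j)
    have := kernel_nonneg m (-θ + u j)
    simp only [H]; positivity
  have hHsum : ∀ θ, ∑ j ∈ range (m + 2), H θ j = (m + 2) * mass m := fun θ => by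
    simp only [H, u]
    rw [← sum_div, sum_add_distrib, sum_kernel_node, sum_kernel_node]
    ring
  have hHdist : ∀ θ, ∑ j ∈ range (m + 2), H θ j * |cos θ - cos (u j)|
      ≤ π / (m + 2) * ((m + 2) * mass m) := fun θ => by
    have h1 := sum_kernel_mul_dist_le m θ
    have h2 := sum_kernel_mul_dist_le m (-θ)
    rw [cos_neg] at h2
    have h3 : ∑ j ∈ range (m + 2), H θ j * |cos θ - cos (u j)|
        = (∑ j ∈ range (m + 2), kernel m (θ + u j) * |cos θ - cos (u j)|
          + ∑ j ∈ range (m + 2), kernel m (-θ + u j) * |cos θ - cos (u j)|) / 2 := by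
      rw [← sum_add_distrib, sum_div]
      exact sum_congr rfl fun j _ => by simp only [H]; ring
    rw [h3]
    linarith
  have hHcos : ∀ θ j, H θ j = ∑ k ∈ range (m + 1), ∑ l ∈ range (m + 1),
      sineCoeff m k * sineCoeff m l * cos (((k : ℤ) - l : ℤ) * u j) * cos (((k : ℤ) - l : ℤ) * θ) := by
    intro θ j
    simp only [H, kernel]
    rw [← sum_add_distrib, sum_div]
    refine sum_congr rfl fun k _ => ?_
    rw [← sum_add_distrib, sum_div]
    refine sum_congr rfl fun l _ => ?_
    rw [mul_add, mul_add, mul_neg, cos_add, cos_add, cos_neg, sin_neg]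
    ring
  let p : ℝ[X] := ∑ j ∈ range (m + 2), ∑ k ∈ range (m + 1), ∑ l ∈ range (m + 1),
    C (F (cos (u j)) / ((m + 2) * mass m) *
      (sineCoeff m k * sineCoeff m l * cos (((k : ℤ) - l : ℤ) * u j))) * Chebyshev.T ℝ ((k : ℤ) - l)
  have hp : ∀ θ, p.eval (cos θ)
      = (∑ j ∈ range (m + 2), F (cos (u j)) * H θ j) / ((m + 2) * mass m) := fun θ => by
    simp only [p, eval_finsetSum, eval_mul, eval_C, Chebyshev.T_real_cos, hHcos]
    rw [sum_div]
    refine sum_congr rfl fun j _ => ?_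
    rw [mul_div_right_comm, mul_sum]
    refine sum_congr rfl fun k _ => ?_
    rw [mul_sum]
    exact sum_congr rfl fun l _ => by ring
  refine ⟨p, ?_, fun x hx => ?_⟩
  · refine natDegree_sum_le_of_forall_le _ _ fun j _ =>
      natDegree_sum_le_of_forall_le _ _ fun k hk => natDegree_sum_le_of_forall_le _ _ fun l hl => ?_
    rw [mem_range] at hk hl
    refine (natDegree_C_mul_le _ _).trans ?_
    rw [Chebyshev.natDegree_T]
    omega
  · obtain ⟨θ, rfl⟩ : ∃ θ, cos θ = x := ⟨arccos x, cos_arccos hx.1 hx.2⟩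
    have hdiff : F (cos θ) - p.eval (cos θ)
        = (∑ j ∈ range (m + 2), H θ j * (F (cos θ) - F (cos (u j)))) / ((m + 2) * mass m) := by
      rw [hp, eq_div_iff hM.ne', sub_mul, div_mul_cancel₀ _ hM.ne', ← hHsum θ, mul_sum,
        ← sum_sub_distrib]
      exact sum_congr rfl fun j _ => by ring
    rw [hdiff, abs_div, abs_of_pos hM, div_le_iff₀ hM]
    calc _ ≤ ∑ j ∈ range (m + 2), L * (H θ j * |cos θ - cos (u j)|) := by
          refine (abs_sum_le_sum_abs _ _).trans (sum_le_sum fun j _ => ?_)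
          rw [abs_mul, abs_of_nonneg (hH0 θ j)]
          calc _ ≤ H θ j * (L * |cos θ - cos (u j)|) :=
                mul_le_mul_of_nonneg_left (hF _ _) (hH0 θ j)
            _ = _ := by ring
      _ ≤ L * (π / (m + 2) * ((m + 2) * mass m)) := by
          rw [← mul_sum]
          exact mul_le_mul_of_nonneg_left (hHdist θ) hL
      _ = _ := by ring

end Korovkin

namespace Hypercube
open Finset

variable {n : ℕ}

/-! ### Degree on the cube -/

theorem flip_involutive (j : Fin n) : Function.Involutive fun x : Cube n => flip x j := by
  intro x
  simp [flip]

theorem walsh_eq_prod (S : Finset (Fin n)) (x : Cube n) :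
    walsh S x = ∏ j ∈ S, (-1 : ℝ) ^ (x j).toNat := by
  rw [walsh, prod_pow_eq_pow_sum]

theorem walsh_congr {S : Finset (Fin n)} {x y : Cube n} (h : ∀ i ∈ S, x i = y i) :
    walsh S x = walsh S y := by
  rw [walsh, walsh, sum_congr rfl fun i hi => by rw [h i hi]]

theorem walsh_flip_of_mem {S : Finset (Fin n)} {j : Fin n} (hj : j ∈ S) (x : Cube n) :
    walsh S (flip x j) = -walsh S x := by
  have h : ∏ i ∈ S.erase j, (-1 : ℝ) ^ (flip x j i).toNat
      = ∏ i ∈ S.erase j, (-1 : ℝ) ^ (x i).toNat :=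
    prod_congr rfl fun i hi => by rw [flip, Function.update_of_ne (ne_of_mem_erase hi)]
  rw [walsh_eq_prod, walsh_eq_prod, ← mul_prod_erase S _ hj, ← mul_prod_erase S _ hj, h, flip,
    Function.update_self]
  cases x j <;> simp

/-- A function that does not depend on some coordinate in `S` is orthogonal to `walsh S`: flipping
that coordinate changes the sign of every term. -/
theorem sum_mul_walsh_eq_zero {S : Finset (Fin n)} {j : Fin n} (hj : j ∈ S) {h : Cube n → ℝ}
    (hh : ∀ x, h (flip x j) = h x) : ∑ x, h x * walsh S x = 0 := by
  have := Equiv.sum_comp (flip_involutive j).toPerm fun x => h x * walsh S x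
  simp only [Function.Involutive.coe_toPerm, hh, walsh_flip_of_mem hj, mul_neg,
    sum_neg_distrib] at this
  linarith

/-- Orthogonality of the columns of the Walsh matrix. -/
theorem sum_walsh_mul_walsh (x y : Cube n) :
    ∑ S, walsh S y * walsh S x = if y = x then (2 : ℝ) ^ n else 0 := by
  simp_rw [walsh_eq_prod, ← prod_mul_distrib]
  rw [← powerset_univ, ← prod_one_add]
  split_ifs with h
  · subst h
    have : ∀ i, (1 : ℝ) + (-1) ^ (y i).toNat * (-1) ^ (y i).toNat = 2 := fun i => by
      cases y i <;> norm_num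
    simp [this]
  · obtain ⟨i, hi⟩ := Function.ne_iff.1 h
    refine prod_eq_zero (mem_univ i) ?_
    cases hy : y i <;> cases hx : x i <;> simp_all

theorem sum_walshCoeff_mul_walsh (g : Cube n → ℝ) (x : Cube n) :
    ∑ S, walshCoeff g S * walsh S x = g x := by
  have h : ∀ S, walshCoeff g S * walsh S x
      = ∑ y, g y / 2 ^ n * (walsh S y * walsh S x) := fun S => by
    rw [walshCoeff, sum_div, sum_mul]
    exact sum_congr rfl fun y _ => by ring
  simp_rw [h]
  rw [sum_comm]
  simp_rw [← mul_sum, sum_walsh_mul_walsh]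
  simp

theorem walshCoeff_eq_zero_of_degree_lt {g : Cube n → ℝ} {S : Finset (Fin n)}
    (h : degree g < S.card) : walshCoeff g S = 0 := by
  refine Nat.sInf_mem (s := {m | ∀ S : Finset (Fin n), m < S.card → walshCoeff g S = 0})
    ⟨n, fun S hS => ?_⟩ S h
  have := card_finset_fin_le S
  omega

theorem degree_le {g : Cube n → ℝ} {m : ℕ}
    (h : ∀ S : Finset (Fin n), m < S.card → ∑ x, g x * walsh S x = 0) : degree g ≤ m :=
  Nat.sInf_le fun S hS => by rw [walshCoeff, h S hS, zero_div]

theorem approxError_le {d : ℝ} {f g : Cube n → ℝ} (hg : (degree g : ℝ) ≤ d) :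
    approxError d f ≤ ‖f - g‖ :=
  ciInf_le (f := fun g : {g : Cube n → ℝ // (degree g : ℝ) ≤ d} => ‖f - g.1‖)
    ⟨0, by rintro _ ⟨g, rfl⟩; exact norm_nonneg _⟩ ⟨g, hg⟩

/-! ### Functions of the Hamming weight -/

/-- The number of ones of `x`. -/
def hammingWeight (x : Cube n) : ℕ := ∑ i, (x i).toNat

theorem hammingWeight_le (x : Cube n) : hammingWeight x ≤ n := by
  refine (sum_le_sum (g := fun _ => 1) fun i _ => Bool.toNat_le _).trans ?_
  simp

theorem hammingWeight_flip_add (x : Cube n) (j : Fin n) :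
    hammingWeight (flip x j) + (x j).toNat = hammingWeight x + (!(x j)).toNat := by
  have h : ∑ i ∈ univ.erase j, (flip x j i).toNat = ∑ i ∈ univ.erase j, (x i).toNat :=
    sum_congr rfl fun i hi => by rw [flip, Function.update_of_ne (ne_of_mem_erase hi)]
  rw [hammingWeight, hammingWeight, ← add_sum_erase univ _ (mem_univ j),
    ← add_sum_erase univ (fun i => (x i).toNat) (mem_univ j), h, flip, Function.update_self]
  omega

theorem hammingWeight_flip_of_false {x : Cube n} {j : Fin n} (h : x j = false) :
    hammingWeight (flip x j) = hammingWeight x + 1 := by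
  simpa [h] using hammingWeight_flip_add x j

theorem hammingWeight_of_true {x : Cube n} {j : Fin n} (h : x j = true) :
    hammingWeight x = hammingWeight (flip x j) + 1 := by
  simpa [h] using (hammingWeight_flip_add x j).symm

theorem hammingWeight_eq_card (x : Cube n) : hammingWeight x = #{i | x i = true} := by
  rw [hammingWeight, card_filter]
  exact sum_congr rfl fun i _ => by cases x i <;> rfl

/-- Two points of equal weight differ by a permutation, which extends a bijection between their
sets of ones. -/
theorem IsSymmetric.eq_of_hammingWeight_eq {f : Cube n → ℝ} (hf : IsSymmetric f) {x y : Cube n}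
    (h : hammingWeight x = hammingWeight y) : f x = f y := by
  have hc : Fintype.card {i // x i = true} = Fintype.card {i // y i = true} := by
    rw [Fintype.card_subtype, Fintype.card_subtype, ← hammingWeight_eq_card,
      ← hammingWeight_eq_card, h]
  let e := Fintype.equivOfCardEq hc
  have hxy : (fun i => y (e.extendSubtype i)) = x := by
    funext i
    by_cases hi : x i = true
    · rw [hi, e.extendSubtype_mem i hi]
    · rw [Bool.eq_false_iff.2 hi, Bool.eq_false_iff]
      exact e.extendSubtype_not_mem i hi
  rw [← hf e.extendSubtype y, hxy]

theorem isSymmetric_comp_hammingWeight (φ : ℕ → ℝ) :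
    IsSymmetric fun x : Cube n => φ (hammingWeight x) := fun σ x =>
  congrArg φ (Equiv.sum_comp σ fun i => (x i).toNat)

/-- The point of the cube whose first `k` coordinates are `1`. -/
def initialPoint (n k : ℕ) : Cube n := fun i => decide ((i : ℕ) < k)

theorem hammingWeight_initialPoint {k : ℕ} (hk : k ≤ n) :
    hammingWeight (initialPoint n k) = k := by
  simp [hammingWeight_eq_card, initialPoint, Fin.card_filter_val_lt, hk]

theorem sum_abs_sub_flip_le_sensitivity (f : Cube n → ℝ) (x : Cube n) :
    ∑ j, |f x - f (flip x j)| ≤ sensitivity f :=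
  le_sup' (fun x : Cube n => ∑ j, |f x - f (flip x j)|) (mem_univ x)

theorem sensitivity_nonneg (f : Cube n → ℝ) : 0 ≤ sensitivity f :=
  (sum_nonneg fun _ _ => abs_nonneg _).trans
    (sum_abs_sub_flip_le_sensitivity f fun _ => false)

theorem card_mul_abs_le_sensitivity (f : Cube n → ℝ) (x : Cube n) (s : Finset (Fin n)) {a : ℝ}
    (h : ∀ j ∈ s, |f x - f (flip x j)| = a) : #s * a ≤ sensitivity f := by
  refine le_trans ?_ (sum_abs_sub_flip_le_sensitivity f x)
  rw [← nsmul_eq_mul, ← sum_const, ← sum_congr rfl h]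
  exact sum_le_sum_of_subset_of_nonneg (subset_univ s) fun _ _ _ => abs_nonneg _

/-- A point of weight `k` has `n - k` neighbours of weight `k + 1`, and a point of weight `k + 1` has
`k + 1` neighbours of weight `k`; the larger of the two numbers is at least `n / 2`. -/
theorem mul_abs_step_le_sensitivity (φ : ℕ → ℝ) {k : ℕ} (hk : k < n) :
    n * |φ k - φ (k + 1)| ≤ 2 * sensitivity fun x : Cube n => φ (hammingWeight x) := by
  set f : Cube n → ℝ := fun x => φ (hammingWeight x) with hf
  have h1 := card_mul_abs_le_sensitivity f (initialPoint n k)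
    {j | initialPoint n k j = false} (a := |φ k - φ (k + 1)|) fun j hj => by
      rw [hf]
      simp only
      rw [hammingWeight_flip_of_false (mem_filter.1 hj).2, hammingWeight_initialPoint hk.le]
  have h2 := card_mul_abs_le_sensitivity f (initialPoint n (k + 1))
    {j | initialPoint n (k + 1) j = true} (a := |φ k - φ (k + 1)|) fun j hj => by
      have h := hammingWeight_of_true (mem_filter.1 hj).2
      rw [hammingWeight_initialPoint hk] at h
      rw [hf]
      simp only
      rw [hammingWeight_initialPoint hk, ← Nat.succ_injective h, abs_sub_comm]
  rw [← hammingWeight_eq_card, hammingWeight_initialPoint hk] at h2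
  have h3 : #{j | initialPoint n k j = false} = n - k := by
    simp only [initialPoint, decide_eq_false_iff_not]
    have := card_filter_add_card_filter_not (s := (univ : Finset (Fin n))) fun j => (j : ℕ) < k
    rw [Fin.card_filter_val_lt, card_univ, Fintype.card_fin] at this
    omega
  rw [h3, Nat.cast_sub hk.le] at h1
  push_cast at h2
  linarith [abs_nonneg (φ k - φ (k + 1))]

open Polynomial in
theorem degree_eval_hammingWeight_le (p : ℝ[X]) :
    degree (fun x : Cube n => p.eval (hammingWeight x : ℝ)) ≤ p.natDegree := by
  refine degree_le fun S hS => ?_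
  have hmono : ∀ k ∈ range (p.natDegree + 1),
      ∑ x : Cube n, (hammingWeight x : ℝ) ^ k * walsh S x = 0 := by
    intro k hk
    have hk : k < #S := by rw [mem_range] at hk; omega
    -- `|x|^k` is a sum of products of `k` coordinates, none of which involves all of `S`.
    have hexp : ∀ x : Cube n, (hammingWeight x : ℝ) ^ k * walsh S x
        = ∑ v : Fin k → Fin n, (∏ i, ((x (v i)).toNat : ℝ)) * walsh S x := fun x => by
      rw [hammingWeight, Nat.cast_sum, Fintype.sum_pow, sum_mul]
    simp_rw [hexp]
    rw [sum_comm]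
    refine sum_eq_zero fun v _ => ?_
    obtain ⟨j, hjS, hj⟩ : ∃ j ∈ S, j ∉ univ.image v := by
      refine exists_mem_notMem_of_card_lt_card (lt_of_le_of_lt card_image_le ?_)
      simpa using hk
    refine sum_mul_walsh_eq_zero hjS fun x => prod_congr rfl fun i _ => ?_
    rw [flip, Function.update_of_ne]
    exact fun h => hj (mem_image.2 ⟨i, mem_univ i, h⟩)
  simp_rw [eval_eq_sum_range, sum_mul, mul_assoc]
  rw [sum_comm]
  refine sum_eq_zero fun k hk => ?_
  rw [← mul_sum, hmono k hk, mul_zero]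

/-- A function on `{0, …, n}` with increments at most `L` extends to an `L`-Lipschitz function on
the line. -/
theorem exists_lipschitz_extension (φ : ℕ → ℝ) {L : ℝ} (hL : 0 ≤ L)
    (h : ∀ k < n, |φ k - φ (k + 1)| ≤ L) :
    ∃ F : ℝ → ℝ, (∀ x y, |F x - F y| ≤ L * |x - y|) ∧ ∀ k ≤ n, F k = φ k := by
  have hadd : ∀ k l : ℕ, k + l ≤ n → |φ k - φ (k + l)| ≤ L * l := by
    intro k l
    induction l with
    | zero => simp
    | succ l ih =>
      intro hl
      have h1 := ih (by omega)
      have h2 := h (k + l) (by omega)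
      have h3 := abs_sub_le (φ k) (φ (k + l)) (φ (k + (l + 1)))
      rw [← add_assoc] at h3 ⊢
      push_cast
      linarith
  have hdist : ∀ k ≤ n, ∀ l ≤ n, |φ k - φ l| ≤ L * |(k : ℝ) - l| := by
    intro k hk l hl
    rcases le_total k l with hkl | hkl
    · obtain ⟨c, rfl⟩ := Nat.exists_eq_add_of_le hkl
      simpa using hadd k c hl
    · obtain ⟨c, rfl⟩ := Nat.exists_eq_add_of_le hkl
      rw [abs_sub_comm]
      simpa using hadd l c hk
  have hlip : LipschitzOnWith L.toNNReal (fun t : ℝ => φ ⌊t⌋₊) {t | ∃ k ≤ n, (k : ℝ) = t} := by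
    refine LipschitzOnWith.of_dist_le_mul ?_
    rintro _ ⟨k, hk, rfl⟩ _ ⟨l, hl, rfl⟩
    simpa [Real.dist_eq, hL] using hdist k hk l hl
  obtain ⟨F, hF, hFeq⟩ := hlip.extend_real
  refine ⟨F, fun x y => ?_, fun k hk => ?_⟩
  · simpa [Real.dist_eq, hL] using hF.dist_le_mul x y
  · simpa using (hFeq ⟨k, hk, rfl⟩).symm

open Polynomial in
/-- The direct estimate: a symmetric function is a Lipschitz function of the Hamming weight, and
algebraic polynomials in the weight approximate it. -/
theorem approxError_le_of_isSymmetric {f : Cube n → ℝ} (hf : IsSymmetric f) {d : ℝ} (hd : 0 < d)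
    (hdn : d ≤ n) : approxError d f ≤ Real.pi / d * sensitivity f := by
  have hn : (0 : ℝ) < n := hd.trans_le hdn
  set s := sensitivity f with hs
  have hs0 : 0 ≤ s := sensitivity_nonneg f
  let φ : ℕ → ℝ := fun k => f (initialPoint n k)
  have hfφ : f = fun x => φ (hammingWeight x) := funext fun x =>
    hf.eq_of_hammingWeight_eq (hammingWeight_initialPoint (hammingWeight_le x)).symm
  have hstep : ∀ k < n, |φ k - φ (k + 1)| ≤ 2 * s / n := fun k hk => by
    rw [le_div_iff₀ hn, mul_comm, hs]
    conv_rhs => rw [hfφ]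
    exact mul_abs_step_le_sensitivity φ hk
  obtain ⟨F, hF, hFφ⟩ := exists_lipschitz_extension φ (by positivity) hstep
  -- Rescaling `[-1, 1]` to `[0, n]` turns the Lipschitz constant `2 s / n` into `s`.
  have hG : ∀ x y, |F (n / 2 * (x + 1)) - F (n / 2 * (y + 1))| ≤ s * |x - y| := fun x y => by
    refine (hF _ _).trans (le_of_eq ?_)
    rw [← mul_sub, add_sub_add_right_eq_sub, abs_mul, abs_of_pos (by positivity : (0 : ℝ) < n / 2)]
    field_simp
  obtain ⟨p, hpdeg, hp⟩ := Korovkin.exists_polynomial_near_of_lipschitz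
    (fun x => F (n / 2 * (x + 1))) s hG ⌊d⌋₊
  let q : ℝ[X] := p.comp (C (2 / (n : ℝ)) * X + C (-1))
  have hqdeg : q.natDegree ≤ ⌊d⌋₊ := by
    refine natDegree_comp_le.trans ?_
    calc _ ≤ p.natDegree * 1 := Nat.mul_le_mul_left _ natDegree_linear_le
      _ ≤ _ := by rwa [mul_one]
  have hdeg : (degree (fun x : Cube n => q.eval (hammingWeight x : ℝ)) : ℝ) ≤ d :=
    (Nat.cast_le.2 ((degree_eval_hammingWeight_le q).trans hqdeg)).trans (Nat.floor_le hd.le)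
  refine (approxError_le hdeg).trans ?_
  rw [pi_norm_le_iff_of_nonneg (by positivity)]
  intro x
  have hx : (hammingWeight x : ℝ) ≤ n := Nat.cast_le.2 (hammingWeight_le x)
  have hx0 : (0 : ℝ) ≤ hammingWeight x := Nat.cast_nonneg _
  have hmem : 2 / (n : ℝ) * hammingWeight x + -1 ∈ Set.Icc (-1 : ℝ) 1 := by
    constructor
    · have : 0 ≤ 2 / (n : ℝ) * hammingWeight x := by positivity
      linarith
    · have : 2 / (n : ℝ) * hammingWeight x ≤ 2 := by
        rw [div_mul_eq_mul_div, div_le_iff₀ hn]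
        linarith
      linarith
  have h := hp _ hmem
  have harg : n / 2 * (2 / (n : ℝ) * hammingWeight x + -1 + 1) = hammingWeight x := by
    field_simp
    ring
  simp only [harg, hFφ _ (hammingWeight_le x)] at h
  have hval : (f - fun x : Cube n => q.eval (hammingWeight x : ℝ)) x
      = φ (hammingWeight x) - p.eval (2 / (n : ℝ) * hammingWeight x + -1) := by
    rw [Pi.sub_apply, hfφ]
    simp [q]
  rw [hval, Real.norm_eq_abs]
  refine h.trans ?_
  rw [div_mul_eq_mul_div]
  gcongr
  linarith [Nat.lt_floor_add_one d]

/-! ### Triangle waves are hard to approximate -/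

/-- The triangle wave of period `2δ` and slope `±1`, with value `δ` at even and `0` at odd multiples
of `δ`. -/
def triangleWave (δ k : ℕ) : ℝ := |((k % (2 * δ) : ℕ) : ℝ) - δ|

theorem abs_triangleWave_sub_succ_le {δ : ℕ} (hδ : 0 < δ) (k : ℕ) :
    |triangleWave δ k - triangleWave δ (k + 1)| ≤ 1 := by
  have hlt : k % (2 * δ) < 2 * δ := Nat.mod_lt _ (by omega)
  have hmod := Nat.mod_add_mod k (2 * δ) 1
  rw [triangleWave, triangleWave, ← hmod]
  set r := k % (2 * δ)
  -- Either `k` and `k + 1` lie in the same period, or `k + 1` starts a new one.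
  rcases (Nat.succ_le_of_lt hlt).lt_or_eq with h | h
  · rw [Nat.mod_eq_of_lt h]
    refine (abs_abs_sub_abs_le _ _).trans ?_
    simp
  · have hr : (r : ℝ) = 2 * δ - 1 := by
      have : ((r + 1 : ℕ) : ℝ) = ((2 * δ : ℕ) : ℝ) := congrArg _ h
      push_cast at this
      linarith
    have hδ1 : (1 : ℝ) ≤ δ := Nat.one_le_cast.2 hδ
    rw [show r + 1 = 2 * δ from h, Nat.mod_self, hr, Nat.cast_zero, zero_sub, abs_neg, Nat.abs_cast,
      abs_of_nonneg (by linarith : (0 : ℝ) ≤ 2 * δ - 1 - δ)]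
    rw [show (2 * δ - 1 - δ - δ : ℝ) = -1 by ring]
    simp

theorem triangleWave_mul (δ t : ℕ) : triangleWave δ (δ * t) = δ / 2 + δ / 2 * (-1) ^ t := by
  rw [triangleWave, mul_comm 2 δ, Nat.mul_mod_mul_left]
  rcases Nat.even_or_odd t with h | h
  · rw [Nat.even_iff.1 h, h.neg_one_pow]
    simp
  · rw [Nat.odd_iff.1 h, h.neg_one_pow]
    simp

theorem sensitivity_triangleWave_le {δ : ℕ} (hδ : 0 < δ) :
    sensitivity (fun x : Cube n => triangleWave δ (hammingWeight x)) ≤ n := by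
  refine sup'_le _ _ fun x _ => ?_
  calc _ ≤ ∑ _j : Fin n, (1 : ℝ) := sum_le_sum fun j _ => ?_
    _ = n := by simp
  cases h : x j with
  | false =>
    simp only [hammingWeight_flip_of_false h]
    exact abs_triangleWave_sub_succ_le hδ _
  | true =>
    simp only [hammingWeight_of_true h]
    rw [abs_sub_comm]
    exact abs_triangleWave_sub_succ_le hδ _

theorem sensitivity_triangleWave_pos {δ : ℕ} (hδ : 0 < δ) (hn : 0 < n) :
    0 < sensitivity (fun x : Cube n => triangleWave δ (hammingWeight x)) := by
  have h := mul_abs_step_le_sensitivity (triangleWave δ) hn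
  have h0 : triangleWave δ 0 - triangleWave δ (0 + 1) = 1 := by
    have hδ1 : (1 : ℝ) ≤ δ := Nat.one_le_cast.2 hδ
    rw [triangleWave, triangleWave, Nat.zero_mod, Nat.mod_eq_of_lt (by omega)]
    simp only [Nat.cast_zero, zero_sub, abs_neg, Nat.abs_cast, zero_add, Nat.cast_one]
    rw [abs_of_nonpos (by linarith)]
    ring
  rw [h0, abs_one, mul_one] at h
  have : (0 : ℝ) < n := Nat.cast_pos.2 hn
  linarith

/-- The point of the `n`-cube that is constant on consecutive blocks of `δ` coordinates, with the
value `T b` on the block with number `b`, and `0` on the coordinates after the last block. -/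
def blockPoint (n δ : ℕ) {M : ℕ} (T : Cube M) : Cube n := fun i =>
  if h : (i : ℕ) / δ < M then T ⟨i / δ, h⟩ else false

theorem hammingWeight_blockPoint {δ M : ℕ} (hδ : 0 < δ) (hn : δ * M ≤ n) (T : Cube M) :
    hammingWeight (blockPoint n δ T) = δ * hammingWeight T := by
  have hcard : ∀ b : Fin M, #{i : Fin n | (i : ℕ) / δ = b} = δ := fun b => by
    have hmap : ({i : Fin n | (i : ℕ) / δ = b} : Finset (Fin n)).map Fin.valEmbedding
        = Ico (b * δ) ((b + 1) * δ) := by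
      have hb : (b + 1) * δ ≤ n := (Nat.mul_le_mul_right δ b.2).trans (by rwa [mul_comm])
      ext i
      simp only [mem_map, mem_filter, mem_univ, true_and, Fin.valEmbedding_apply, mem_Ico]
      constructor
      · rintro ⟨i, hi, rfl⟩
        exact ⟨(Nat.le_div_iff_mul_le hδ).1 hi.ge, (Nat.div_lt_iff_lt_mul hδ).1 (by omega)⟩
      · rintro ⟨h1, h2⟩
        refine ⟨⟨i, h2.trans_le hb⟩, ?_, rfl⟩
        have := (Nat.le_div_iff_mul_le hδ).2 h1
        have := (Nat.div_lt_iff_lt_mul hδ).2 h2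
        simp only
        omega
    rw [← card_map Fin.valEmbedding, hmap, Nat.card_Ico, add_one_mul]
    omega
  have hbit : ∀ i : Fin n, (blockPoint n δ T i).toNat
      = ∑ b : Fin M, if (i : ℕ) / δ = b then (T b).toNat else 0 := fun i => by
    rw [blockPoint]
    split_ifs with h
    · rw [sum_eq_single (⟨i / δ, h⟩ : Fin M)]
      · simp
      · exact fun b _ hb => if_neg fun hib => hb (Fin.ext hib.symm)
      · simp
    · refine (sum_eq_zero fun b _ => if_neg fun hib => h ?_).symm
      rw [hib]
      exact b.2
  rw [hammingWeight, sum_congr rfl fun i _ => hbit i, sum_comm, hammingWeight, mul_sum]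
  refine sum_congr rfl fun b _ => ?_
  rw [← sum_filter, sum_const, hcard, smul_eq_mul]

/-- A Walsh function of at most `m` variables restricts to a function of at most `m` of the `m + 1`
blocks, so its restriction to block points is orthogonal to the parity of the blocks. -/
theorem sum_walsh_blockPoint_mul_parity (n δ : ℕ) {m : ℕ} {S : Finset (Fin n)} (hS : #S ≤ m) :
    ∑ T : Cube (m + 1), walsh S (blockPoint n δ T) * walsh univ T = 0 := by
  obtain ⟨b, hbm, hb⟩ : ∃ b ∈ range (m + 1), b ∉ S.image fun i : Fin n => (i : ℕ) / δ := by
    refine exists_mem_notMem_of_card_lt_card (lt_of_le_of_lt card_image_le ?_)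
    rw [card_range]
    omega
  refine sum_mul_walsh_eq_zero (mem_univ ⟨b, mem_range.1 hbm⟩) fun T => walsh_congr fun i hi => ?_
  rw [blockPoint, blockPoint]
  split_ifs with h
  · rw [flip, Function.update_of_ne]
    exact fun hib => hb (mem_image.2 ⟨i, hi, congrArg Fin.val hib⟩)
  · rfl

/-- On block points the triangle wave is `δ / 2` plus `δ / 2` times the parity of the blocks, and
a function of degree at most `m` does not correlate with that parity. -/
theorem half_le_norm_triangleWave_sub {δ m : ℕ} (hδ : 0 < δ) (hn : δ * (m + 1) ≤ n)
    {g : Cube n → ℝ} (hg : degree g ≤ m) :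
    (δ / 2 : ℝ) ≤ ‖(fun x : Cube n => triangleWave δ (hammingWeight x)) - g‖ := by
  set f : Cube n → ℝ := fun x => triangleWave δ (hammingWeight x) with hf
  have hsq : ∀ T : Cube (m + 1), walsh univ T * walsh univ T = 1 := fun T => by
    rw [walsh, ← mul_pow]
    norm_num
  have hparity : ∑ T : Cube (m + 1), walsh univ T = 0 := by
    simpa [walsh] using sum_walsh_blockPoint_mul_parity n δ (m := m) (S := ∅) (by simp)
  have hg0 : ∑ T : Cube (m + 1), g (blockPoint n δ T) * walsh univ T = 0 := by
    simp_rw [← sum_walshCoeff_mul_walsh g, sum_mul, mul_assoc]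
    rw [sum_comm]
    refine sum_eq_zero fun S _ => ?_
    rw [← mul_sum]
    rcases le_or_gt #S m with hS | hS
    · rw [sum_walsh_blockPoint_mul_parity n δ hS, mul_zero]
    · rw [walshCoeff_eq_zero_of_degree_lt (hg.trans_lt hS), zero_mul]
  have hfT : ∀ T : Cube (m + 1), f (blockPoint n δ T) * walsh univ T
      = δ / 2 * walsh univ T + δ / 2 := fun T => by
    have hw : walsh univ T = (-1) ^ hammingWeight T := rfl
    rw [hf]
    simp only
    rw [hammingWeight_blockPoint hδ hn, triangleWave_mul, ← hw, add_mul, mul_assoc _ _ (walsh _ _),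
      hsq, mul_one]
  have hf0 : ∑ T : Cube (m + 1), f (blockPoint n δ T) * walsh univ T
      = 2 ^ (m + 1) * (δ / 2) := by
    simp_rw [hfT]
    rw [sum_add_distrib, ← mul_sum, hparity]
    simp
  have hle : (2 ^ (m + 1) * (δ / 2) : ℝ) ≤ 2 ^ (m + 1) * ‖f - g‖ := by
    rw [← hf0, ← sub_zero (∑ T : Cube (m + 1), _), ← hg0, ← sum_sub_distrib]
    calc _ ≤ ∑ _T : Cube (m + 1), ‖f - g‖ := sum_le_sum fun T _ => ?_
      _ = _ := by simp
    have h1 : |walsh univ T| = 1 := by simp [walsh]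
    rw [← sub_mul]
    refine (le_abs_self _).trans ?_
    rw [abs_mul, h1, mul_one]
    exact norm_le_pi_norm (f - g) (blockPoint n δ T)
  exact le_of_mul_le_mul_left hle (by positivity)

/-- The triangle wave with `⌊d⌋₊ + 1` half-periods that are as long as possible. -/
theorem exists_symmetric_sensitivity_le_approxError {d : ℝ} (hd : 1 ≤ d) (hdn : d < n) :
    ∃ f : Cube n → ℝ, IsSymmetric f ∧ 0 < sensitivity f ∧
      1 / (8 * d) * sensitivity f ≤ approxError d f := by
  set m := ⌊d⌋₊
  have hm1 : 1 ≤ m := Nat.one_le_floor_iff d |>.2 hd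
  have hd0 : 0 ≤ d := by linarith
  have hmd : (m : ℝ) ≤ d := Nat.floor_le hd0
  have hmn : m < n := (Nat.floor_lt hd0).2 hdn
  set δ := n / (m + 1)
  have hδ : 0 < δ := Nat.div_pos hmn m.succ_pos
  have hδn : δ * (m + 1) ≤ n := Nat.div_mul_le_self n (m + 1)
  -- Since `δ ≥ 1` and `m ≥ 1`, rounding and the `+ 1` lose a factor `2` each.
  have hn4 : n ≤ 4 * m * δ := by
    have := Nat.lt_mul_div_succ n m.succ_pos
    calc n ≤ (m + 1) * (δ + 1) := this.le
      _ ≤ (2 * m) * (2 * δ) := Nat.mul_le_mul (by omega) (by omega)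
      _ = 4 * m * δ := by ring
  refine ⟨_, isSymmetric_comp_hammingWeight (triangleWave δ),
    sensitivity_triangleWave_pos hδ (by omega), ?_⟩
  have : Nonempty {g : Cube n → ℝ // (degree g : ℝ) ≤ d} :=
    ⟨0, by
      have h0 : degree (0 : Cube n → ℝ) ≤ 0 := degree_le fun S _ => by simp
      rw [Nat.le_zero.1 h0]
      simpa using hd0⟩
  refine le_ciInf fun g => le_trans ?_ (half_le_norm_triangleWave_sub hδ hδn (Nat.le_floor g.2))
  have hn4' : (n : ℝ) ≤ 4 * m * δ := by exact_mod_cast hn4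
  have hmδ : (m : ℝ) * δ ≤ d * δ := by gcongr
  rw [one_div_mul_eq_div, div_le_iff₀ (by linarith)]
  refine (sensitivity_triangleWave_le hδ).trans ?_
  linarith

end Hypercube

theorem proposition1 :
    (∃ C : ℝ, 0 < C ∧
      ∀ (n : ℕ) (f : Hypercube.Cube n → ℝ), Hypercube.IsSymmetric f →
        ∀ d : ℝ, 0 < d → d ≤ n →
          Hypercube.approxError d f ≤ C / d * Hypercube.sensitivity f) ∧
    (∀ (n : ℕ) (d : ℝ), 1 ≤ d → d < n →
      ∃ f : Hypercube.Cube n → ℝ, Hypercube.IsSymmetric f ∧ 0 < Hypercube.sensitivity f ∧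
        1 / (8 * d) * Hypercube.sensitivity f ≤ Hypercube.approxError d f) :=
  ⟨⟨Real.pi, Real.pi_pos, fun _ _ hf _ hd hdn =>
    Hypercube.approxError_le_of_isSymmetric hf hd hdn⟩,
    fun _ _ hd hdn => Hypercube.exists_symmetric_sensitivity_le_approxError hd hdn⟩
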